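/- Let $k$ be a subfield of $\mathbb{C}$ and let $A$ be a totally ordered set of letters, each letter $a$ having a positive integer degree $|a|$, with only finitely many letters in each degree. Let $\bar A=A\cup\{0\}$ and let $[\cdot,\cdot]:\bar A\times\bar A\to\bar A$ be a function satisfying - (S0) $[a,0]=0$ for all $a\in\bar A$; - (S1) $[a,b]=[b,a]$ for all $a,b\in\bar A$; - (S2) $[[a,b],c]=[a,[b,c]]$ for all $a,b,c\in\bar A$; - (S3) for all $a,b\in A$, either $[a,b]=0$ or $|[a,b]|=|a|+|b|$. Let $\mathfrak{A}=k\langle A\rangle$ be the $k$-vector space with basis the words (finite sequences of letters, including the empty word $1$), and let $*$ be the $k$-bilinear product on $\mathfrak{A}$ determined by $1*w=w*1=w$ for every word $w$ and $$aw_1*bw_2=a(w_1*bw_2)+b(aw_1*w_2)+[a,b](w_1*w_2)$$ for all letters $a,b$ and words $w_1,w_2$, where juxtaposition is concatenation and $0\cdot w=0$; this makes $(\mathfrak{A},*)$ a commutative $k$-algebra with unit $1$. Order the words lexicographically: $u<uv$ for every nonempty word $v$, and $w_1aw_2<w_1bw_3$ for all letters $a<b$ and words $w_1,w_2,w_3$.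 A word $w\neq 1$ is called Lyndon if $w<v$ for every factorization $w=uv$ with $u,v\ne 1$. **Theorem.** $(\mathfrak{A},*)$ is the free polynomial algebra on the Lyndon words: the homomorphism of $k$-algebras from the polynomial algebra $k[X_w : w \text{ a Lyndon word}]$ to $(\mathfrak{A},*)$ sending each $X_w$ to $w$ is bijective. -/

import Mathlib

/-- A bracket on `Ā = A ∪ {0}` (here `WithZero A`), where the letters `a : A` have degrees `deg a`:
it satisfies `[a,0] = 0`, is commutative and associative, and adds degrees of letters unless it
vanishes. -/
structure LetterBracket {A : Type*} (deg : A → ℕ) where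
  /-- the operation `[·,·] : Ā × Ā → Ā` -/
  br : WithZero A → WithZero A → WithZero A
  br_zero : ∀ a, br a 0 = 0
  br_comm : ∀ a b, br a b = br b a
  br_assoc : ∀ a b c, br (br a b) c = br a (br b c)
  br_deg : ∀ a b : A, br a b = 0 ∨ ∃ c : A, br a b = c ∧ deg c = deg a + deg b

/-- The underlying vector space of `k⟨A⟩`: formal `k`-linear combinations of words, a word being a
list of letters. It is equipped below with the quasi-shuffle product of the bracket `B`
(and not with concatenation). -/
def QuasiShuffle (k : Type*) [CommRing k] {A : Type*} {deg : A → ℕ} (_B : LetterBracket deg) :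
    Type _ :=
  List A →₀ k

namespace QuasiShuffle

noncomputable section

variable {k : Type*} [CommRing k] {A : Type*} {deg : A → ℕ} {B : LetterBracket deg}

instance instAddCommGroup : AddCommGroup (QuasiShuffle k B) :=
  inferInstanceAs (AddCommGroup (List A →₀ k))

instance instModule : Module k (QuasiShuffle k B) :=
  inferInstanceAs (Module k (List A →₀ k))

variable (k B) in
/-- The basis of the vector space `k⟨A⟩` given by the words. -/
def wordBasis : Module.Basis (List A) k (QuasiShuffle k B) :=
  Module.Basis.ofRepr (LinearEquiv.refl k (List A →₀ k))

variable (k B) in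
/-- A word, viewed as an element of `k⟨A⟩`. -/
def word (w : List A) : QuasiShuffle k B :=
  wordBasis k B w

variable (k B) in
/-- Left concatenation with `x ∈ Ā`: the linear map `w ↦ xw` for `x` a letter, and `0` for
`x = 0`. -/
def lcons (x : WithZero A) : QuasiShuffle k B →ₗ[k] QuasiShuffle k B :=
  WithZero.recZeroCoe (motive := fun _ => QuasiShuffle k B →ₗ[k] QuasiShuffle k B) 0
    (fun a => (wordBasis k B).constr k (fun w => word k B (a :: w))) x

variable (k B) in
/-- The quasi-shuffle product of two words:
`1 * w = w * 1 = w` and `au * bv = a(u * bv) + b(au * v) + [a,b](u * v)`. -/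
def mulWord : List A → List A → QuasiShuffle k B
  | [], v => word k B v
  | a :: u, [] => word k B (a :: u)
  | a :: u, b :: v =>
      lcons k B a (mulWord u (b :: v)) + lcons k B b (mulWord (a :: u) v)
        + lcons k B (B.br a b) (mulWord u v)
  termination_by u v => u.length + v.length

variable (k B) in
/-- The quasi-shuffle product, the bilinear extension of the product of words. -/
def mulBilin : QuasiShuffle k B →ₗ[k] QuasiShuffle k B →ₗ[k] QuasiShuffle k B :=
  (wordBasis k B).constr k (fun u => (wordBasis k B).constr k (fun v => mulWord k B u v))

instance instMul : Mul (QuasiShuffle k B) := ⟨fun x y => mulBilin k B x y⟩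

instance instOne : One (QuasiShuffle k B) := ⟨word k B []⟩

theorem mul_def (x y : QuasiShuffle k B) : x * y = mulBilin k B x y := rfl

theorem one_def : (1 : QuasiShuffle k B) = word k B [] := rfl

theorem word_mul_word (u v : List A) : word k B u * word k B v = mulWord k B u v := by
  simp [mul_def, mulBilin, word]

@[simp] theorem lcons_zero : lcons k B 0 = 0 := rfl

@[simp] theorem lcons_coe_word (a : A) (w : List A) :
    lcons k B a (word k B w) = word k B (a :: w) :=
  (wordBasis k B).constr_basis k (fun w => word k B (a :: w)) w

/-- Linear maps out of `k⟨A⟩` that agree on words agree. -/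
theorem hom_ext {M : Type*} [AddCommGroup M] [Module k M] {f g : QuasiShuffle k B →ₗ[k] M}
    (h : ∀ w, f (word k B w) = g (word k B w)) : f = g :=
  (wordBasis k B).ext h

theorem word_nil_mul (x : QuasiShuffle k B) : word k B [] * x = x := by
  have h : mulBilin k B (word k B []) = LinearMap.id :=
    hom_ext fun w => by
      rw [← mul_def, word_mul_word, mulWord]; rfl
  exact congrArg (fun f => f x) h

theorem mulWord_comm (u v : List A) : mulWord k B u v = mulWord k B v u := by
  induction u generalizing v with
  | nil => cases v <;> simp [mulWord]
  | cons a u ihu =>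
    induction v with
    | nil => simp [mulWord]
    | cons b v ihv =>
      rw [mulWord, mulWord, ihu (b :: v), ihv, ihu v, B.br_comm a b]
      abel

theorem mul_comm' (x y : QuasiShuffle k B) : x * y = y * x := by
  have h : mulBilin k B = (mulBilin k B).flip :=
    hom_ext fun u => hom_ext fun v => by
      rw [LinearMap.flip_apply, ← mul_def, ← mul_def, word_mul_word, word_mul_word, mulWord_comm]
  exact congrArg (fun f => f x y) h

protected theorem add_mul' (x y z : QuasiShuffle k B) : (x + y) * z = x * z + y * z := by
  simp [mul_def]

protected theorem mul_add' (x y z : QuasiShuffle k B) : x * (y + z) = x * y + x * z := by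
  simp [mul_def]

/-- The recursion for the product, for arbitrary elements and arbitrary `c, d ∈ Ā`. -/
theorem lcons_mul_lcons (c d : WithZero A) (x y : QuasiShuffle k B) :
    lcons k B c x * lcons k B d y =
      lcons k B c (x * lcons k B d y) + lcons k B d (lcons k B c x * y)
        + lcons k B (B.br c d) (x * y) := by
  induction c using WithZero.recZeroCoe with
  | zero => simp [mul_def, B.br_comm 0 d, B.br_zero]
  | coe a =>
  induction d using WithZero.recZeroCoe with
  | zero => simp [mul_def, B.br_zero]
  | coe b =>
  have h : (mulBilin k B).compl₁₂ (lcons k B a) (lcons k B b) =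
      ((mulBilin k B).compl₂ (lcons k B b)).compr₂ (lcons k B a)
        + ((mulBilin k B).comp (lcons k B a)).compr₂ (lcons k B b)
        + (mulBilin k B).compr₂ (lcons k B (B.br a b)) :=
    hom_ext fun u => hom_ext fun v => by
      simp only [LinearMap.compl₁₂_apply, LinearMap.add_apply, LinearMap.compr₂_apply,
        LinearMap.compl₂_apply, LinearMap.comp_apply, lcons_coe_word, ← mul_def, word_mul_word]
      rw [mulWord]
  exact congrArg (fun f => f x y) h

theorem lcons_mul_mul_left (c d e : WithZero A) (x y z : QuasiShuffle k B) :
    lcons k B c x * lcons k B d y * lcons k B e z =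
      lcons k B c (x * lcons k B d y * lcons k B e z)
        + lcons k B d (lcons k B c x * y * lcons k B e z)
        + lcons k B e (lcons k B c x * lcons k B d y * z)
        + lcons k B (B.br c e) (x * lcons k B d y * z)
        + lcons k B (B.br d e) (lcons k B c x * y * z)
        + lcons k B (B.br c d) (x * y * lcons k B e z)
        + lcons k B (B.br (B.br c d) e) (x * y * z) := by
  rw [lcons_mul_lcons c d x y]
  simp only [QuasiShuffle.add_mul', map_add]
  rw [lcons_mul_lcons c e, lcons_mul_lcons d e, lcons_mul_lcons (B.br c d) e]
  abel

theorem mul_lcons_mul_left (c d e : WithZero A) (x y z : QuasiShuffle k B) :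
    lcons k B c x * (lcons k B d y * lcons k B e z) =
      lcons k B c (x * (lcons k B d y * lcons k B e z))
        + lcons k B d (lcons k B c x * (y * lcons k B e z))
        + lcons k B e (lcons k B c x * (lcons k B d y * z))
        + lcons k B (B.br c e) (x * (lcons k B d y * z))
        + lcons k B (B.br d e) (lcons k B c x * (y * z))
        + lcons k B (B.br c d) (x * (y * lcons k B e z))
        + lcons k B (B.br c (B.br d e)) (x * (y * z)) := by
  rw [lcons_mul_lcons d e y z]
  simp only [QuasiShuffle.mul_add', map_add]
  rw [lcons_mul_lcons c d, lcons_mul_lcons c e, lcons_mul_lcons c (B.br d e)]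
  abel

theorem word_mul_assoc (u v w : List A) :
    word k B u * word k B v * word k B w = word k B u * (word k B v * word k B w) := by
  induction u generalizing v w with
  | nil => rw [word_nil_mul, word_nil_mul]
  | cons a u ihu =>
  induction v generalizing w with
  | nil => rw [mul_comm' (word k B (a :: u)), word_nil_mul, word_nil_mul]
  | cons b v ihv =>
  induction w with
  | nil => rw [mul_comm' _ (word k B []), mul_comm' _ (word k B []), word_nil_mul, word_nil_mul]
  | cons c w ihw =>
  have e1 := ihu (b :: v) (c :: w)
  have e2 := ihu (b :: v) w
  have e3 := ihv (c :: w)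
  have e4 := ihv w
  have e5 := ihu v (c :: w)
  have e6 := ihu v w
  simp only [← lcons_coe_word] at e1 e2 e3 e4 e5 e6 ihw ⊢
  rw [lcons_mul_mul_left, mul_lcons_mul_left, e1, e2, e3, e4, e5, e6, ihw, B.br_assoc]

theorem mul_assoc' (x y z : QuasiShuffle k B) : x * y * z = x * (y * z) := by
  have hx : ∀ x, x ∈ Submodule.span k (Set.range (wordBasis k B)) := fun x => by
    rw [(wordBasis k B).span_eq]; trivial
  induction hx x using Submodule.span_induction with
  | zero => simp [mul_def]
  | add a b _ _ ha hb => simp only [QuasiShuffle.add_mul', ha, hb]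
  | smul r a _ ha => simpa [mul_def] using congrArg (r • ·) ha
  | mem a ha =>
  obtain ⟨u, rfl⟩ := ha
  induction hx y using Submodule.span_induction with
  | zero => simp [mul_def]
  | add a b _ _ ha hb => simp only [QuasiShuffle.add_mul', QuasiShuffle.mul_add', ha, hb]
  | smul r a _ ha => simpa [mul_def] using congrArg (r • ·) ha
  | mem a ha =>
  obtain ⟨v, rfl⟩ := ha
  induction hx z using Submodule.span_induction with
  | zero => simp [mul_def]
  | add a b _ _ ha hb => simp only [QuasiShuffle.mul_add', ha, hb]
  | smul r a _ ha => simpa [mul_def] using congrArg (r • ·) ha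
  | mem a ha =>
  obtain ⟨w, rfl⟩ := ha
  exact word_mul_assoc u v w

instance instCommRing : CommRing (QuasiShuffle k B) where
  __ := instAddCommGroup
  __ := instMul
  __ := instOne
  left_distrib := QuasiShuffle.mul_add'
  right_distrib := QuasiShuffle.add_mul'
  zero_mul x := by simp [mul_def]
  mul_zero x := by simp [mul_def]
  mul_assoc := mul_assoc'
  one_mul := word_nil_mul
  mul_one x := (mul_comm' x _).trans (word_nil_mul x)
  mul_comm := mul_comm'

instance instAlgebra : Algebra k (QuasiShuffle k B) :=
  Algebra.ofModule (fun r x y => by simp [mul_def]) (fun r x y => by simp [mul_def])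

end

end QuasiShuffle

/-- A word is Lyndon if it is nonempty and lexicographically strictly smaller than all its proper
nonempty right factors. The order `<` on lists is the lexicographic one, in which a proper prefix
of a word is smaller than the word. -/
def IsLyndon {A : Type*} [LinearOrder A] (w : List A) : Prop :=
  w ≠ [] ∧ ∀ u v : List A, u ≠ [] → v ≠ [] → w = u ++ v → w < v

/-!
The words are ordered by `WordPrec`: shorter words come first, and words that are rearrangements of
each other are compared lexicographically. For this order the map from the polynomial algebra is
triangular. By the Chen–Fox–Lyndon theorem (`IsLyndonFactorization.exists_flatten_eq`,
`IsLyndonFactorization.eq_of_flatten_eq`) the monomials in the Lyndon words correspond bijectively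
to the words, by concatenating the factors `l₁ ≥ l₂ ≥ ⋯ ≥ lₙ` of a monomial in nonincreasing order,
and the quasi-shuffle product of `l₁, …, lₙ` has `l₁ l₂ ⋯ lₙ` as its largest word, with a positive
integer as coefficient (`QuasiShuffle.hasLeadingWord_prod`). As the order is well-founded and the
characteristic is zero, bijectivity follows.

The bracket terms of a quasi-shuffle product only contribute shorter words, so the statement on
leading words is one about ordinary shuffles: if `l` is Lyndon and `v` is a product of Lyndon words
bounded by `l`, no shuffle of `l` and `v` exceeds `l ++ v` (`Shuffle.le_append`). To see this, read
words as numbers in a large base `N`, and shift all digits by the constant that gives `l` the value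
`0`, which does not affect the comparison of words of the same length. A Lyndon word is smaller than
its rotations, whence every suffix of `l` has nonnegative value and every prefix of `v` nonpositive
value. Compared with `l ++ v`, in a shuffle the weights of the letters of `l` are divided by powers
of `N`, larger ones for later letters, and the weights of the letters of `v` are multiplied by powers
of `N`, larger ones for earlier letters. By partial summation, the signs show that the value can only
drop (`Shuffle.wordVal_le`).
-/

/-! ### Lexicographic comparison and Lyndon words -/

section Lex

variable {A : Type*} [LinearOrder A]

theorem List.lt_append_of_ne_nil (u : List A) {v : List A} (hv : v ≠ []) : u < u ++ v := by
  induction u with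
  | nil => cases v with
    | nil => exact absurd rfl hv
    | cons b v => exact List.nil_lt_cons b v
  | cons a u ih => exact List.cons_lt_cons_iff.2 (Or.inr ⟨rfl, ih⟩)

theorem List.le_append_self_right (u v : List A) : u ≤ u ++ v := by
  rcases eq_or_ne v [] with rfl | hv
  · simp
  · exact (u.lt_append_of_ne_nil hv).le

theorem List.append_lt_append_left_iff (u : List A) {v w : List A} :
    u ++ v < u ++ w ↔ v < w := by
  induction u with
  | nil => rfl
  | cons a u ih => simp [ih]

/-- If `u < v`, then either `u` is a proper prefix of `v`, or the two words differ at some position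
of both, so that the inequality persists whatever is appended to them. -/
theorem List.prefix_or_forall_append_lt {u v : List A} (h : u < v) :
    (∃ r, r ≠ [] ∧ v = u ++ r) ∨ ∀ x y, u ++ x < v ++ y := by
  induction u generalizing v with
  | nil =>
    refine Or.inl ⟨v, ?_, rfl⟩
    rintro rfl
    exact lt_irrefl _ h
  | cons a u ih =>
    cases v with
    | nil => exact absurd h (List.not_lt_nil _)
    | cons b v =>
      rcases List.cons_lt_cons_iff.1 h with hab | ⟨rfl, huv⟩
      · exact Or.inr fun x y => List.cons_lt_cons_iff.2 (Or.inl hab)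
      · rcases ih huv with ⟨r, hr, rfl⟩ | h'
        · exact Or.inl ⟨r, hr, rfl⟩
        · exact Or.inr fun x y => List.cons_lt_cons_iff.2 (Or.inr ⟨rfl, h' x y⟩)

namespace IsLyndon

variable {u v : List A}

theorem singleton (a : A) : IsLyndon [a] := by
  refine ⟨by simp, fun u v hu hv h => ?_⟩
  have := congrArg List.length h
  have h1 := List.length_pos_iff.2 hu
  have h2 := List.length_pos_iff.2 hv
  simp at this
  omega

theorem lt_append_left (hv : IsLyndon v) (hu : u ≠ []) (h : u < v) : u ++ v < v := by
  rcases List.prefix_or_forall_append_lt h with ⟨r, hr, rfl⟩ | h'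
  · exact (List.append_lt_append_left_iff u).2 (hv.2 u r hu hr rfl)
  · simpa using h' v []

theorem append (hu : IsLyndon u) (hv : IsLyndon v) (h : u < v) : IsLyndon (u ++ v) := by
  have huv : u ++ v < v := hv.lt_append_left hu.1 h
  refine ⟨by simp [hu.1], fun p s hp hs hps => ?_⟩
  rcases List.append_eq_append_iff.1 hps with ⟨q, rfl, rfl⟩ | ⟨q, rfl, rfl⟩
  · rcases eq_or_ne q [] with rfl | hq
    · simpa using huv
    · exact huv.trans (hv.2 q s hq hs rfl)
  · rcases eq_or_ne q [] with rfl | hq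
    · simpa using huv
    · rcases List.prefix_or_forall_append_lt (hu.2 p q hp hq rfl) with ⟨r, hr, hqr⟩ | h'
      · have := congrArg List.length hqr
        have hp' := List.length_pos_iff.2 hp
        simp at this
        omega
      · exact h' v v

theorem append_le_append_comm (hv : IsLyndon v) (h : u ≤ v) :
    u ++ v ≤ v ++ u := by
  rcases h.eq_or_lt with rfl | h
  · rfl
  rcases eq_or_ne u [] with rfl | hu
  · simp
  rcases List.prefix_or_forall_append_lt h with ⟨r, hr, rfl⟩ | h'
  · rw [List.append_assoc]
    exact ((List.append_lt_append_left_iff u).2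
      ((hv.2 u r hu hr rfl).trans_le (List.le_append_self_right r u))).le
  · exact (h' v u).le

end IsLyndon

/-! ### Factorization into nonincreasing Lyndon words -/

/-- A Lyndon factorization: a nonincreasing list of Lyndon words, standing for the factorization
`L.flatten = l₁ l₂ ⋯ lₙ`. -/
def IsLyndonFactorization (L : List (List A)) : Prop :=
  (∀ l ∈ L, IsLyndon l) ∧ L.Pairwise (· ≥ ·)

namespace IsLyndonFactorization

theorem of_cons {l : List A} {L : List (List A)} (h : IsLyndonFactorization (l :: L)) :
    IsLyndonFactorization L :=
  ⟨fun x hx => h.1 x (List.mem_cons_of_mem _ hx), (List.pairwise_cons.1 h.2).2⟩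

theorem exists_cons_append {l : List A} (hl : IsLyndon l) {L : List (List A)}
    (hL : IsLyndonFactorization L) :
    ∃ L', IsLyndonFactorization L' ∧ L'.flatten = l ++ L.flatten := by
  induction L generalizing l with
  | nil => exact ⟨[l], ⟨by simpa using hl, by simp⟩, by simp⟩
  | cons m L ih =>
    rcases lt_or_ge l m with hlm | hlm
    · obtain ⟨L', hL', h⟩ := ih (hl.append (hL.1 m (by simp)) hlm) hL.of_cons
      exact ⟨L', hL', by simp [h]⟩
    · refine ⟨l :: m :: L, ⟨?_, List.pairwise_cons.2 ⟨?_, hL.2⟩⟩, by simp⟩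
      · intro x hx
        rcases List.mem_cons.1 hx with rfl | hx
        · exact hl
        · exact hL.1 x hx
      · intro x hx
        rcases List.mem_cons.1 hx with rfl | hx
        · exact hlm
        · exact ((List.pairwise_cons.1 hL.2).1 x hx).trans hlm

theorem exists_flatten_eq (w : List A) : ∃ L, IsLyndonFactorization L ∧ L.flatten = w := by
  induction w with
  | nil => exact ⟨[], ⟨by simp, by simp⟩, rfl⟩
  | cons a w ih =>
    obtain ⟨L, hL, rfl⟩ := ih
    exact exists_cons_append (IsLyndon.singleton a) hL

/-- A nonempty prefix of a product of words bounded by `c` has a nonempty suffix bounded by `c`,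
namely its intersection with the last factor that it meets. -/
theorem exists_suffix_le {L : List (List A)} {c : List A} (hL : ∀ l ∈ L, l ≤ c) {q r : List A}
    (hq : q ≠ []) (h : q ++ r = L.flatten) : ∃ p s, q = p ++ s ∧ s ≠ [] ∧ s ≤ c := by
  induction L generalizing q with
  | nil => simp_all
  | cons l L ih =>
    have hlc := hL l (by simp)
    rw [List.flatten_cons] at h
    rcases List.append_eq_append_iff.1 h with ⟨t, rfl, -⟩ | ⟨t, rfl, ht⟩
    · exact ⟨[], q, rfl, hq, (List.le_append_self_right q t).trans hlc⟩
    · rcases eq_or_ne t [] with rfl | ht0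
      · exact ⟨[], l, by simp, by simpa using hq, hlc⟩
      · obtain ⟨p, s, rfl, hs, hsc⟩ := ih (fun x hx => hL x (List.mem_cons_of_mem _ hx)) ht0 ht.symm
        exact ⟨l ++ p, s, by simp, hs, hsc⟩

/-- The first factor of a Lyndon factorization is the longest Lyndon prefix of the product. -/
theorem length_le {l m : List A} {L : List (List A)} (h : IsLyndonFactorization (l :: L))
    (hm : IsLyndon m) {r : List A} (hr : m ++ r = l ++ L.flatten) : m.length ≤ l.length := by
  rcases List.append_eq_append_iff.1 hr with ⟨t, rfl, -⟩ | ⟨t, rfl, ht⟩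
  · simp
  rcases eq_or_ne t [] with rfl | ht0
  · simp
  exfalso
  obtain ⟨p, s, rfl, hs, hsl⟩ := exists_suffix_le (List.pairwise_cons.1 h.2).1 ht0 ht.symm
  have h1 := hm.2 (l ++ p) s (by simp [(h.1 l (by simp)).1]) hs (by simp)
  exact lt_irrefl _ ((List.lt_append_of_ne_nil l ht0).trans (h1.trans_le hsl))

theorem eq_of_flatten_eq {L M : List (List A)} (hL : IsLyndonFactorization L)
    (hM : IsLyndonFactorization M) (h : L.flatten = M.flatten) : L = M := by
  induction L generalizing M with
  | nil =>
    cases M with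
    | nil => rfl
    | cons m M => exact absurd (by simpa using h.symm) (fun e => (hM.1 m (by simp)).1 (And.left e))
  | cons l L ih =>
    cases M with
    | nil => exact absurd (by simpa using h) (fun e => (hL.1 l (by simp)).1 (And.left e))
    | cons m M =>
      rw [List.flatten_cons, List.flatten_cons] at h
      have h1 := hL.length_le (hM.1 m (by simp)) h.symm
      have h2 := hM.length_le (hL.1 l (by simp)) h
      obtain ⟨rfl, h3⟩ := List.append_inj h (le_antisymm h2 h1)
      rw [ih hL.of_cons hM.of_cons h3]

end IsLyndonFactorization

end Lex

/-! ### Shuffles -/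

/-- `Shuffle u v w` means that `w` is obtained by interleaving the words `u` and `v`. -/
inductive Shuffle {A : Type*} : List A → List A → List A → Prop
  | nil : Shuffle [] [] []
  | left {u v w : List A} (a : A) : Shuffle u v w → Shuffle (a :: u) v (a :: w)
  | right {u v w : List A} (b : A) : Shuffle u v w → Shuffle u (b :: v) (b :: w)

namespace Shuffle

variable {A : Type*} {u v w : List A}

theorem nil_left (v : List A) : Shuffle [] v v := by
  induction v with
  | nil => exact nil
  | cons b v ih => exact ih.right b

theorem nil_right (u : List A) : Shuffle u [] u := by
  induction u with
  | nil => exact nil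
  | cons a u ih => exact ih.left a

theorem perm (h : Shuffle u v w) : w.Perm (u ++ v) := by
  induction h with
  | nil => rfl
  | left a _ ih => exact ih.cons a
  | right b _ ih => exact (ih.cons b).trans List.perm_middle.symm

theorem length_eq (h : Shuffle u v w) : w.length = u.length + v.length := by
  simpa using h.perm.length_eq

theorem exists_of_length_eq (h : Shuffle u v w) {v' : List A} (hlen : v.length = v'.length) :
    ∃ w', Shuffle u v' w' := by
  induction h generalizing v' with
  | nil =>
    rw [List.length_nil, eq_comm, List.length_eq_zero_iff] at hlen
    exact ⟨[], hlen ▸ nil⟩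
  | left a _ ih =>
    obtain ⟨w', h'⟩ := ih hlen
    exact ⟨_, h'.left a⟩
  | right b _ ih =>
    cases v' with
    | nil => simp at hlen
    | cons c v' =>
      obtain ⟨w', h'⟩ := ih (by simpa using hlen)
      exact ⟨_, h'.right c⟩

/-- Interleaving along the same pattern is strictly monotone in the second word. -/
theorem exists_lt [LinearOrder A] (h : Shuffle u v w) {v' : List A} (hlen : v.length = v'.length)
    (hv : v < v') : ∃ w', Shuffle u v' w' ∧ w < w' := by
  induction h generalizing v' with
  | nil =>
    rw [List.length_nil, eq_comm, List.length_eq_zero_iff] at hlen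
    exact absurd (hlen ▸ hv) (lt_irrefl _)
  | left a _ ih =>
    obtain ⟨w', h1, h2⟩ := ih hlen hv
    exact ⟨a :: w', h1.left a, List.cons_lt_cons_iff.2 (Or.inr ⟨rfl, h2⟩)⟩
  | @right u v w b h ih =>
    cases v' with
    | nil => simp at hlen
    | cons b' v' =>
      rw [List.length_cons, List.length_cons, Nat.add_right_cancel_iff] at hlen
      rcases List.cons_lt_cons_iff.1 hv with hb | ⟨rfl, hv'⟩
      · obtain ⟨w', hw'⟩ := h.exists_of_length_eq hlen
        exact ⟨b' :: w', hw'.right b', List.cons_lt_cons_iff.2 (Or.inl hb)⟩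
      · obtain ⟨w', h1, h2⟩ := ih hlen hv'
        exact ⟨b :: w', h1.right b, List.cons_lt_cons_iff.2 (Or.inr ⟨rfl, h2⟩)⟩

end Shuffle

/-! ### Numerical values of words -/

/-- The value of a word in base `N`, when each letter `a` stands for the digit `ν a`. Digits may be
arbitrary rational numbers. -/
def wordVal {A : Type*} (N : ℚ) (ν : A → ℚ) : List A → ℚ
  | [] => 0
  | a :: w => ν a * N ^ w.length + wordVal N ν w

section WordVal

variable {A : Type*} {N : ℚ} {ν : A → ℚ}

theorem wordVal_append (u v : List A) :
    wordVal N ν (u ++ v) = wordVal N ν u * N ^ v.length + wordVal N ν v := by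
  induction u with
  | nil => simp [wordVal]
  | cons a u ih =>
    simp only [List.cons_append, wordVal, ih, List.length_append, pow_add]
    ring

theorem wordVal_sub_const (θ : ℚ) (w : List A) :
    wordVal N (fun a => ν a - θ * (N - 1)) w = wordVal N ν w - θ * (N ^ w.length - 1) := by
  induction w with
  | nil => simp [wordVal]
  | cons a w ih =>
    simp only [wordVal, ih, List.length_cons, pow_succ]
    ring

/-- The value of a shuffle of `s` and `t` is at most that of `s ++ t` as soon as all suffixes of `s`
have nonnegative value and all prefixes of `t` have nonpositive value. In the induction, the number
`c` is the value of the part of `t` that has already been read. -/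
theorem Shuffle.wordVal_le (hN : 1 ≤ N) {s t z : List A} (h : Shuffle s t z) (c : ℚ)
    (hs : ∀ p, p <:+ s → 0 ≤ wordVal N ν p)
    (ht : ∀ p, p <+: t → c * N ^ p.length + wordVal N ν p ≤ 0) :
    c * N ^ z.length + wordVal N ν z ≤
      wordVal N ν s * N ^ t.length + (c * N ^ t.length + wordVal N ν t) := by
  have hN0 : 0 ≤ N := zero_le_one.trans hN
  induction h generalizing c with
  | nil => simp [wordVal]
  | @left s t z a h ih =>
    have ih' := ih c (fun p hp => hs p (hp.trans (List.suffix_cons a s))) ht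
    have hc : c ≤ 0 := by simpa [wordVal] using ht [] List.nil_prefix
    have hpow : N ^ z.length ≤ N ^ (z.length + 1) := pow_le_pow_right₀ hN (Nat.le_succ _)
    have hmul := mul_le_mul_of_nonpos_left hpow hc
    have hz : N ^ z.length = N ^ s.length * N ^ t.length := by rw [h.length_eq, pow_add]
    simp only [wordVal, List.length_cons]
    linear_combination ih' + hmul + ν a * hz
  | @right s t z b h ih =>
    have hs0 := hs s (List.suffix_refl s)
    have ih' := ih (c * N + ν b) hs (fun p hp => by
      have := ht (b :: p) ((List.prefix_cons_inj b).2 hp)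
      simp only [wordVal, List.length_cons, pow_succ] at this
      linarith)
    have hpow : N ^ t.length ≤ N ^ (t.length + 1) := pow_le_pow_right₀ hN (Nat.le_succ _)
    have hmul := mul_le_mul_of_nonneg_left hpow hs0
    simp only [wordVal, List.length_cons]
    simp only [pow_succ] at *
    linarith

/-- On a finite set `F` of letters, the digits `ν a = #{b ∈ F | b < a}` make the value of words of a
given length strictly increasing for the lexicographic order. -/
theorem exists_wordVal_strictMono [LinearOrder A] (F : Finset A) :
    ∃ (N : ℚ) (ν : A → ℚ), 1 < N ∧ ∀ u v : List A, (∀ a ∈ u, a ∈ F) → (∀ a ∈ v, a ∈ F) →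
      u.length = v.length → u < v → wordVal N ν u < wordVal N ν v := by
  set ν : A → ℚ := fun a => (F.filter (· < a)).card with hν
  set N : ℚ := F.card + 2 with hN
  have hN1 : 1 < N := by
    have : (0 : ℚ) ≤ F.card := Nat.cast_nonneg _
    linarith
  have hν0 : ∀ a, 0 ≤ ν a := fun a => Nat.cast_nonneg _
  have hνN : ∀ a, ν a + 1 ≤ N := fun a => by
    have : ν a ≤ F.card := Nat.cast_le.2 (Finset.card_filter_le _ _)
    linarith
  have hνlt : ∀ a ∈ F, ∀ b, a < b → ν a + 1 ≤ ν b := fun a ha b hab => by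
    have : (F.filter (· < a)).card < (F.filter (· < b)).card := by
      refine Finset.card_lt_card (Finset.ssubset_iff_of_subset ?_ |>.2 ⟨a, ?_, ?_⟩)
      · intro x hx
        rw [Finset.mem_filter] at hx ⊢
        exact ⟨hx.1, hx.2.trans hab⟩
      · simp [ha, hab]
      · simp
    simp only [hν]
    exact_mod_cast this
  have hpos : ∀ n : ℕ, 0 < N ^ n := fun n => pow_pos (by linarith) n
  have hval0 : ∀ w, 0 ≤ wordVal N ν w := fun w => by
    induction w with
    | nil => simp [wordVal]
    | cons a w ih => exact add_nonneg (mul_nonneg (hν0 a) (hpos _).le) ih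
  have hvallt : ∀ w, wordVal N ν w < N ^ w.length := fun w => by
    induction w with
    | nil => simp [wordVal]
    | cons a w ih =>
      have := mul_le_mul_of_nonneg_right (hνN a) (hpos w.length).le
      simp only [wordVal, List.length_cons, pow_succ]
      linarith
  refine ⟨N, ν, hN1, fun u => ?_⟩
  induction u with
  | nil =>
    intro v _ _ hlen h
    rw [List.length_nil, eq_comm, List.length_eq_zero_iff] at hlen
    exact absurd (hlen ▸ h) (lt_irrefl _)
  | cons a u ih =>
    intro v hu hv hlen h
    cases v with
    | nil => simp at hlen
    | cons b v =>
      have hlen' : u.length = v.length := by simpa using hlen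
      simp only [wordVal, hlen']
      rcases List.cons_lt_cons_iff.1 h with hab | ⟨rfl, huv⟩
      · have h1 := mul_le_mul_of_nonneg_right (hνlt a (hu a (by simp)) b hab) (hpos v.length).le
        have h2 := hvallt u
        have h3 := hval0 v
        rw [hlen'] at h2
        linarith
      · have := ih v (fun x hx => hu x (List.mem_cons_of_mem _ hx))
          (fun x hx => hv x (List.mem_cons_of_mem _ hx)) hlen' huv
        linarith

/-! ### The largest shuffle of Lyndon words -/

/-- The number with the periodic expansion `0.www⋯` in base `N`. Comparing the slopes of `u` and `v`
amounts to comparing the values of `u ++ v` and `v ++ u`. For `w = []` the slope is `0 / 0 = 0`. -/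
def wordSlope (N : ℚ) (ν : A → ℚ) (w : List A) : ℚ :=
  wordVal N ν w / (N ^ w.length - 1)

theorem one_lt_pow_length (hN : 1 < N) {w : List A} (hw : w ≠ []) : 1 < N ^ w.length :=
  one_lt_pow₀ hN (List.length_pos_iff.2 hw).ne'

theorem wordVal_eq_wordSlope_mul (hN : 1 < N) (w : List A) :
    wordVal N ν w = wordSlope N ν w * (N ^ w.length - 1) := by
  rcases eq_or_ne w [] with rfl | hw
  · simp [wordVal]
  · rw [wordSlope, div_mul_cancel₀]
    linarith [one_lt_pow_length hN hw]

theorem wordSlope_le_of_append_le (hN : 1 < N) {u v : List A} (hu : u ≠ []) (hv : v ≠ [])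
    (h : wordVal N ν (u ++ v) ≤ wordVal N ν (v ++ u)) : wordSlope N ν u ≤ wordSlope N ν v := by
  rw [wordVal_append, wordVal_append] at h
  rw [wordSlope, wordSlope, div_le_div_iff₀ (by linarith [one_lt_pow_length hN hu])
    (by linarith [one_lt_pow_length hN hv])]
  linarith

/-- If `s ++ p` is at least `p ++ s` (as when `p ++ s` is Lyndon), the slope of `p` is at most that
of `p ++ s`, which is at most that of `s`. Clearing denominators allows for empty `p` and `s`. -/
theorem wordVal_prefix_suffix (hN : 1 < N) {p s : List A}
    (h : wordVal N ν (p ++ s) ≤ wordVal N ν (s ++ p)) :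
    wordVal N ν p ≤ wordSlope N ν (p ++ s) * (N ^ p.length - 1) ∧
      wordSlope N ν (p ++ s) * (N ^ s.length - 1) ≤ wordVal N ν s := by
  rcases eq_or_ne p [] with rfl | hp
  · simpa [wordVal] using (wordVal_eq_wordSlope_mul hN s).ge
  rcases eq_or_ne s [] with rfl | hs
  · simpa [wordVal] using (wordVal_eq_wordSlope_mul hN p).le
  have hl := wordVal_eq_wordSlope_mul (ν := ν) hN (p ++ s)
  set θ := wordSlope N ν (p ++ s)
  rw [wordVal_append, wordVal_append] at h
  rw [wordVal_append, List.length_append, pow_add] at hl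
  have hp1 := one_lt_pow_length hN hp
  have hs1 := one_lt_pow_length hN hs
  set D := N ^ p.length
  set E := N ^ s.length
  set P := wordVal N ν p
  set S := wordVal N ν s
  have hDE : 0 < D * E - 1 := by nlinarith
  have h1 : 0 ≤ (S - θ * (E - 1)) * (D * E - 1) := by
    have : (S - θ * (E - 1)) * (D * E - 1) = E * (S * D + P - (P * E + S)) := by
      linear_combination (E - 1) * hl
    rw [this]
    exact mul_nonneg (by linarith) (by linarith)
  have h2 : 0 ≤ S - θ * (E - 1) := nonneg_of_mul_nonneg_left h1 hDE
  refine ⟨?_, by linarith⟩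
  have h3 : (P - θ * (D - 1)) * E ≤ 0 := by
    have : (P - θ * (D - 1)) * E = -(S - θ * (E - 1)) := by linear_combination hl
    rw [this]
    linarith
  nlinarith

/-- Among the shuffles of a Lyndon word `l` with a product of Lyndon words bounded by `l`, the
concatenation is the largest one. -/
theorem Shuffle.le_append [LinearOrder A] {l z : List A} {L : List (List A)} (hl : IsLyndon l)
    (hL : ∀ x ∈ L, IsLyndon x ∧ x ≤ l) (h : Shuffle l L.flatten z) : z ≤ l ++ L.flatten := by
  by_contra! hlt
  obtain ⟨N, ν, hN, hmono⟩ := exists_wordVal_strictMono (l ++ L.flatten).toFinset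
  have hle : ∀ u v : List A, (∀ a ∈ u, a ∈ l ++ L.flatten) → (∀ a ∈ v, a ∈ l ++ L.flatten) →
      u.length = v.length → u ≤ v → wordVal N ν u ≤ wordVal N ν v := by
    intro u v hu hv hlen huv
    rcases huv.eq_or_lt with rfl | huv
    · exact le_rfl
    · exact (hmono u v (fun a ha => List.mem_toFinset.2 (hu a ha))
        (fun a ha => List.mem_toFinset.2 (hv a ha)) hlen huv).le
  have hz := hmono (l ++ L.flatten) z (fun a ha => List.mem_toFinset.2 ha)
    (fun a ha => List.mem_toFinset.2 (h.perm.mem_iff.1 ha)) h.perm.length_eq.symm hlt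
  have hrot : ∀ p s : List A, IsLyndon (p ++ s) → (∀ a ∈ p ++ s, a ∈ l ++ L.flatten) →
      wordVal N ν (p ++ s) ≤ wordVal N ν (s ++ p) := by
    intro p s hps hmem
    refine hle _ _ hmem (fun a ha => hmem a (List.perm_append_comm.mem_iff.1 ha))
      List.perm_append_comm.length_eq ?_
    rcases eq_or_ne p [] with rfl | hp
    · simp
    rcases eq_or_ne s [] with rfl | hs
    · simp
    exact (hps.2 p s hp hs rfl).le.trans (List.le_append_self_right s p)
  have hmemL : ∀ x ∈ L, ∀ a ∈ x, a ∈ l ++ L.flatten := fun x hx a ha =>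
    List.mem_append_right _ (List.mem_flatten.2 ⟨x, hx, ha⟩)
  set θ := wordSlope N ν l with hθ
  -- Shifting the digits by `θ (N - 1)` gives `l` the value `0`.
  set ν' : A → ℚ := fun a => ν a - θ * (N - 1) with hν'
  have hsuf : ∀ p, p <:+ l → 0 ≤ wordVal N ν' p := by
    rintro s ⟨p, rfl⟩
    rw [hν', wordVal_sub_const]
    linarith [(wordVal_prefix_suffix hN (hrot p s hl fun a ha => List.mem_append_left _ ha)).2]
  have hpre1 : ∀ x ∈ L, ∀ p, p <+: x → wordVal N ν' p ≤ 0 := by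
    rintro x hx p ⟨s, rfl⟩
    have h1 := (wordVal_prefix_suffix hN (hrot p s (hL _ hx).1 (hmemL _ hx))).1
    have h2 : wordSlope N ν (p ++ s) ≤ θ := by
      refine wordSlope_le_of_append_le hN (hL _ hx).1.1 hl.1 (hle _ _ ?_ ?_ ?_ ?_)
      · intro a ha
        rcases List.mem_append.1 ha with ha | ha
        · exact hmemL _ hx a ha
        · exact List.mem_append_left _ ha
      · intro a ha
        rcases List.mem_append.1 ha with ha | ha
        · exact List.mem_append_left _ ha
        · exact hmemL _ hx a ha
      · exact List.perm_append_comm.length_eq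
      · exact hl.append_le_append_comm (hL _ hx).2
    have h3 : 0 ≤ N ^ p.length - 1 := sub_nonneg.2 (one_le_pow₀ hN.le)
    rw [hν', wordVal_sub_const]
    linarith [mul_le_mul_of_nonneg_right h2 h3]
  have hpre : ∀ p, p <+: L.flatten → wordVal N ν' p ≤ 0 := by
    clear_value ν' θ
    clear hL hmemL hrot hle hmono hz hlt h
    induction L with
    | nil =>
      intro p hp
      rw [List.prefix_nil.1 hp]
      exact le_rfl
    | cons x L ih =>
      rintro p ⟨r, hr⟩
      rw [List.flatten_cons] at hr
      rcases List.append_eq_append_iff.1 hr with ⟨t, ht, -⟩ | ⟨t, rfl, ht⟩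
      · exact hpre1 x (by simp) p ⟨t, ht.symm⟩
      · rw [wordVal_append]
        have h1 := hpre1 x (by simp) x (List.prefix_refl x)
        have h2 := ih (fun y hy => hpre1 y (List.mem_cons_of_mem _ hy)) t ⟨r, ht.symm⟩
        exact add_nonpos (mul_nonpos_of_nonpos_of_nonneg h1 (pow_nonneg (by linarith) _)) h2
  have hfin := h.wordVal_le (ν := ν') hN.le 0 hsuf (by simpa using hpre)
  simp only [zero_mul, zero_add] at hfin
  rw [← wordVal_append, hν', wordVal_sub_const, wordVal_sub_const, h.perm.length_eq] at hfin
  linarith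

end WordVal

/-! ### Leading words -/

section WordPrec

variable {A : Type*} [LinearOrder A]

/-- The strict partial order on words used for leading terms: `u` precedes `w` if it is shorter, or
if it is a rearrangement of `w` that is lexicographically smaller. Restricting the lexicographic
comparison to rearrangements makes the order well-founded for every alphabet. -/
def WordPrec (u w : List A) : Prop :=
  u.length < w.length ∨ u.Perm w ∧ u < w

namespace WordPrec

theorem irrefl (w : List A) : ¬ WordPrec w w := by
  simp [WordPrec]

theorem trans {u v w : List A} (h₁ : WordPrec u v) (h₂ : WordPrec v w) : WordPrec u w := by
  rcases h₁ with h₁ | ⟨p₁, h₁⟩ <;> rcases h₂ with h₂ | ⟨p₂, h₂⟩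
  · exact Or.inl (h₁.trans h₂)
  · exact Or.inl (p₂.length_eq ▸ h₁)
  · exact Or.inl (p₁.length_eq ▸ h₂)
  · exact Or.inr ⟨p₁.trans p₂, h₁.trans h₂⟩

theorem wellFounded : WellFounded (WordPrec (A := A)) := by
  -- A smaller rearrangement has strictly fewer rearrangements below it.
  let f : List A → ℕ ×ₗ ℕ := fun w =>
    toLex (w.length, (w.permutations.toFinset.filter (· < w)).card)
  refine Subrelation.wf (r := InvImage (· < ·) f) ?_ (InvImage.wf f wellFounded_lt)
  rintro u w (h | ⟨p, h⟩)
  · exact Prod.Lex.toLex_lt_toLex.2 (Or.inl h)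
  · refine Prod.Lex.toLex_lt_toLex.2 (Or.inr ⟨p.length_eq, ?_⟩)
    dsimp only
    refine Finset.card_lt_card ?_
    refine (Finset.ssubset_iff_of_subset ?_).2 ⟨u, ?_, ?_⟩
    · intro x hx
      simp only [Finset.mem_filter, List.mem_toFinset, List.mem_permutations] at hx ⊢
      exact ⟨hx.1.trans p, hx.2.trans h⟩
    · simp [p, h]
    · simp

end WordPrec

end WordPrec

namespace QuasiShuffle

variable {k : Type*} [Field k] {A : Type*} {deg : A → ℕ}
  {B : LetterBracket deg}

/-- The coefficient of the word `w` in an element of `k⟨A⟩`. -/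
noncomputable def coeff (w : List A) : QuasiShuffle k B →ₗ[k] k :=
  (wordBasis k B).coord w

theorem coeff_word [DecidableEq A] (w v : List A) :
    coeff w (word k B v) = if v = w then 1 else 0 := by
  rw [coeff, word, Module.Basis.coord_apply, Module.Basis.repr_self, Finsupp.single_apply]

theorem coeff_lcons_cons [DecidableEq A] (a c : A) (w : List A) (x : QuasiShuffle k B) :
    coeff (c :: w) (lcons k B a x) = if a = c then coeff w x else 0 := by
  have h : (coeff (B := B) (k := k) (c :: w)).comp (lcons k B a) =
      if a = c then coeff w else 0 :=
    hom_ext fun v => by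
      by_cases hac : a = c <;> simp [coeff_word, hac]
  have := congrArg (fun f => f x) h
  by_cases hac : a = c <;> simpa [hac] using this

/-- In the quasi-shuffle product of `u` and `v`, the words of the top length `|u| + |v|` are the
shuffles of `u` and `v`, and their coefficients are natural numbers. -/
theorem exists_nat_coeff_mulWord (u v z : List A) (hz : u.length + v.length ≤ z.length) :
    ∃ n : ℕ, coeff z (mulWord k B u v) = n ∧ (n ≠ 0 → Shuffle u v z) := by
  classical
  induction z generalizing u v with
  | nil =>
    obtain ⟨rfl, rfl⟩ : u = [] ∧ v = [] := by
      simpa [List.length_eq_zero_iff] using hz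
    exact ⟨1, by simp [mulWord, coeff_word], fun _ => Shuffle.nil⟩
  | cons c z ih =>
    cases u with
    | nil =>
      rw [mulWord, coeff_word]
      by_cases h : v = c :: z
      · exact ⟨1, by simp [h], fun _ => h ▸ Shuffle.nil_left v⟩
      · exact ⟨0, by simp [h], fun h0 => absurd rfl h0⟩
    | cons a u =>
      cases v with
      | nil =>
        rw [mulWord, coeff_word]
        by_cases h : a :: u = c :: z
        · exact ⟨1, by simp [h], fun _ => h ▸ Shuffle.nil_right (a :: u)⟩
        · exact ⟨0, by simp [h], fun h0 => absurd rfl h0⟩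
      | cons b v =>
        simp only [List.length_cons] at hz
        obtain ⟨n₁, h₁, hs₁⟩ := ih u (b :: v) (by simp only [List.length_cons]; omega)
        obtain ⟨n₂, h₂, hs₂⟩ := ih (a :: u) v (by simp only [List.length_cons]; omega)
        -- The bracket term only involves words of length less than `|u| + |v|`.
        have h₃ : coeff (c :: z) (lcons k B (B.br a b) (mulWord k B u v)) = 0 := by
          induction B.br a b using WithZero.recZeroCoe with
          | zero => simp
          | coe e =>
            obtain ⟨n, h, hs⟩ := ih u v (by omega)
            rw [coeff_lcons_cons, h]
            have : n = 0 := by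
              by_contra hn
              have := (hs hn).length_eq
              omega
            simp [this]
        refine ⟨(if a = c then n₁ else 0) + (if b = c then n₂ else 0), ?_, fun h => ?_⟩
        · rw [mulWord, map_add, map_add, h₃, coeff_lcons_cons, coeff_lcons_cons, h₁, h₂]
          push_cast
          simp
        · by_cases ha : a = c ∧ n₁ ≠ 0
          · obtain ⟨rfl, hn⟩ := ha
            exact (hs₁ hn).left a
          · by_cases hb : b = c ∧ n₂ ≠ 0
            · obtain ⟨rfl, hn⟩ := hb
              exact (hs₂ hn).right b
            · exfalso
              apply h
              rw [not_and_not_right] at ha hb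
              split_ifs <;> simp_all

theorem exists_pos_coeff_append_mulWord (u v : List A) :
    ∃ n : ℕ, 0 < n ∧ coeff (u ++ v) (mulWord k B u v) = n := by
  classical
  induction u with
  | nil => exact ⟨1, one_pos, by simp [mulWord, coeff_word]⟩
  | cons a u ih =>
    cases v with
    | nil => exact ⟨1, one_pos, by simp [mulWord, coeff_word]⟩
    | cons b v =>
      obtain ⟨n₁, hn₁, h₁⟩ := ih
      obtain ⟨n₂, h₂, -⟩ := exists_nat_coeff_mulWord (k := k) (B := B) (a :: u) v
        (u ++ b :: v) (by simp only [List.length_cons, List.length_append]; omega)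
      have h₃ : coeff (a :: (u ++ b :: v)) (lcons k B (B.br a b) (mulWord k B u v)) = 0 := by
        induction B.br a b using WithZero.recZeroCoe with
        | zero => simp
        | coe e =>
          obtain ⟨n, h, hs⟩ := exists_nat_coeff_mulWord (k := k) (B := B) u v
            (u ++ b :: v) (by simp only [List.length_cons, List.length_append]; omega)
          rw [coeff_lcons_cons, h]
          have : n = 0 := by
            by_contra hn
            have := (hs hn).length_eq
            simp at this
          simp [this]
      refine ⟨n₁ + if b = a then n₂ else 0, by omega, ?_⟩
      rw [List.cons_append, mulWord, map_add, map_add, h₃, coeff_lcons_cons, coeff_lcons_cons,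
        h₁, h₂]
      push_cast
      simp

theorem coeff_word_mul (l z : List A) (x : QuasiShuffle k B) :
    coeff z (word k B l * x) =
      ((wordBasis k B).repr x).sum fun u r => r * coeff z (mulWord k B l u) := by
  conv_lhs => rw [← (wordBasis k B).linearCombination_repr x]
  rw [Finsupp.linearCombination_apply, Finsupp.sum, Finset.mul_sum, map_sum]
  refine Finset.sum_congr rfl fun u _ => ?_
  rw [mul_smul_comm, map_smul, smul_eq_mul]
  exact congrArg _ (congrArg _ (word_mul_word l u))

variable [LinearOrder A]

/-- The element `x` has leading word `w`, with a positive integer as leading coefficient. -/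
def HasLeadingWord (x : QuasiShuffle k B) (w : List A) : Prop :=
  (∃ n : ℕ, 0 < n ∧ coeff w x = n) ∧ ∀ z, coeff z x ≠ 0 → z = w ∨ WordPrec z w

theorem HasLeadingWord.one : HasLeadingWord (1 : QuasiShuffle k B) [] := by
  classical
  refine ⟨⟨1, one_pos, by simp [one_def, coeff_word]⟩, fun z hz => ?_⟩
  rw [one_def, coeff_word] at hz
  exact Or.inl (by simpa [eq_comm] using hz)

/-- The words in the product of `l` with a word that does not exceed a Lyndon factorization `L`
bounded by `l` do not exceed `l ++ L.flatten`. -/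
theorem wordPrec_of_coeff_mulWord_ne_zero {l : List A} {L : List (List A)}
    (h : IsLyndonFactorization (l :: L)) {u z : List A}
    (hu : u = L.flatten ∨ WordPrec u L.flatten) (hz : coeff z (mulWord k B l u) ≠ 0) :
    (z = l ++ L.flatten ∧ u = L.flatten) ∨ WordPrec z (l ++ L.flatten) := by
  have hle : ∀ {y}, Shuffle l L.flatten y → y ≤ l ++ L.flatten := fun hy =>
    hy.le_append (h.1 l (by simp)) fun x hx =>
      ⟨h.of_cons.1 x hx, (List.pairwise_cons.1 h.2).1 x hx⟩
  have hlen : u.length ≤ L.flatten.length := by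
    rcases hu with rfl | hu | ⟨hu, -⟩
    exacts [le_rfl, hu.le, hu.length_eq.le]
  rcases lt_or_ge z.length (l.length + u.length) with hzl | hzl
  · exact Or.inr (Or.inl (by rw [List.length_append]; omega))
  obtain ⟨n, hn, hs⟩ := exists_nat_coeff_mulWord (k := k) (B := B) l u z hzl
  have hsh : Shuffle l u z := hs fun h0 => hz (by rw [hn, h0, Nat.cast_zero])
  rcases hu with rfl | hu | ⟨hp, hu⟩
  · rcases (hle hsh).eq_or_lt with rfl | hlt
    · exact Or.inl ⟨rfl, rfl⟩
    · exact Or.inr (Or.inr ⟨hsh.perm, hlt⟩)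
  · refine Or.inr (Or.inl ?_)
    rw [hsh.length_eq, List.length_append]
    omega
  · obtain ⟨z', hz', hlt⟩ := hsh.exists_lt hp.length_eq hu
    exact Or.inr (Or.inr ⟨hsh.perm.trans (hp.append_left l), hlt.trans_le (hle hz')⟩)

theorem HasLeadingWord.word_mul {l : List A} {L : List (List A)}
    (h : IsLyndonFactorization (l :: L)) {x : QuasiShuffle k B}
    (hx : HasLeadingWord x L.flatten) : HasLeadingWord (word k B l * x) (l ++ L.flatten) := by
  obtain ⟨⟨n, hn0, hn⟩, hlow⟩ := hx
  refine ⟨?_, fun z hz => ?_⟩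
  · obtain ⟨m, hm0, hm⟩ := exists_pos_coeff_append_mulWord (k := k) (B := B) l L.flatten
    refine ⟨n * m, Nat.mul_pos hn0 hm0, ?_⟩
    rw [coeff_word_mul, Finsupp.sum, Finset.sum_eq_single L.flatten]
    · rw [hm, Nat.cast_mul, ← hn]
      rfl
    · intro u hu hne
      by_contra hmul
      rcases wordPrec_of_coeff_mulWord_ne_zero h (hlow u (Finsupp.mem_support_iff.1 hu))
        (right_ne_zero_of_mul hmul) with h' | h'
      · exact hne h'.2
      · exact WordPrec.irrefl _ h'
    · intro hu
      rw [Finsupp.notMem_support_iff.1 hu, zero_mul]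
  · rw [coeff_word_mul] at hz
    obtain ⟨u, hu, hne⟩ := Finset.exists_ne_zero_of_sum_ne_zero hz
    exact (wordPrec_of_coeff_mulWord_ne_zero h (hlow u (Finsupp.mem_support_iff.1 hu))
      (right_ne_zero_of_mul hne)).imp_left And.left

/-- The product of the words of a Lyndon factorization has their concatenation as leading word. -/
theorem hasLeadingWord_prod {L : List (List A)} (h : IsLyndonFactorization L) :
    HasLeadingWord (L.map (word k B)).prod L.flatten := by
  induction L with
  | nil => exact HasLeadingWord.one
  | cons l L ih => simpa using (ih h.of_cons).word_mul h

theorem HasLeadingWord.coeff_ne_zero [CharZero k] {x : QuasiShuffle k B} {w : List A}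
    (h : HasLeadingWord x w) : coeff w x ≠ 0 := by
  obtain ⟨⟨n, hn0, hn⟩, -⟩ := h
  rw [hn]
  exact_mod_cast hn0.ne'

/-- If every word is the leading word of an element of a submodule, the submodule is everything. -/
theorem eq_top_of_hasLeadingWord [CharZero k] {S : Submodule k (QuasiShuffle k B)}
    (hS : ∀ w, ∃ x ∈ S, HasLeadingWord x w) : S = ⊤ := by
  have hword : ∀ w, word k B w ∈ S := fun w => by
    refine WordPrec.wellFounded.induction (C := fun w => word k B w ∈ S) w fun w ih => ?_
    obtain ⟨x, hxS, hx⟩ := hS w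
    have hsum : x = ∑ u ∈ ((wordBasis k B).repr x).support, coeff u x • word k B u :=
      ((wordBasis k B).linearCombination_repr x).symm
    have hmem : w ∈ ((wordBasis k B).repr x).support :=
      Finsupp.mem_support_iff.2 hx.coeff_ne_zero
    rw [← Finset.add_sum_erase _ _ hmem] at hsum
    rw [← S.smul_mem_iff hx.coeff_ne_zero, eq_sub_of_add_eq hsum.symm]
    refine S.sub_mem hxS (S.sum_mem fun u hu => S.smul_mem _ (ih u ?_))
    rw [Finset.mem_erase, Finsupp.mem_support_iff] at hu
    exact (hx.2 u hu.2).resolve_left hu.1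
  rw [eq_top_iff, ← (wordBasis k B).span_eq, Submodule.span_le]
  rintro _ ⟨w, rfl⟩
  exact hword w

/-- A combination of elements with distinct leading words and nonzero coefficients vanishes only if
it has no terms. -/
theorem eq_empty_of_sum_eq_zero [CharZero k] {ι : Type*} {x : ι → QuasiShuffle k B} {W : ι → List A}
    (hW : Function.Injective W) (hx : ∀ i, HasLeadingWord (x i) (W i)) (s : Finset ι) (r : ι → k)
    (h : ∑ i ∈ s, r i • x i = 0) (hr : ∀ i ∈ s, r i ≠ 0) : s = ∅ := by
  by_contra! hs
  -- A linear extension of the order on words singles out the largest leading word.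
  obtain ⟨i, hi, hmax⟩ := s.exists_max_image
    (fun i => (toLex ((W i).length, W i) : ℕ ×ₗ List A)) hs
  have hc := congrArg (coeff (W i)) h
  rw [map_sum, map_zero, Finset.sum_eq_single i] at hc
  · rw [map_smul, smul_eq_mul] at hc
    exact (mul_ne_zero (hr i hi) (hx i).coeff_ne_zero) hc
  · intro j hj hji
    rw [map_smul, smul_eq_mul]
    by_contra hne
    rcases (hx j).2 _ (right_ne_zero_of_mul hne) with h' | h'
    · exact hji (hW h').symm
    · refine (hmax j hj).not_gt (Prod.Lex.toLex_lt_toLex.2 ?_)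
      exact h'.imp_right fun h'' => ⟨h''.1.length_eq, h''.2⟩
  · exact fun h' => absurd hi h'

/-! ### Monomials in the Lyndon words -/

/-- The Lyndon factorization with the multiplicities given by the exponents of a monomial. -/
noncomputable def monomialFactorization (m : {w : List A // IsLyndon w} →₀ ℕ) : List (List A) :=
  ((Finsupp.toMultiset m).sort (· ≥ ·)).map Subtype.val

theorem isLyndonFactorization_monomialFactorization (m : {w : List A // IsLyndon w} →₀ ℕ) :
    IsLyndonFactorization (monomialFactorization m) := by
  refine ⟨fun l hl => ?_, ?_⟩
  · obtain ⟨x, -, rfl⟩ := List.mem_map.1 hl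
    exact x.2
  · exact List.pairwise_map.2 (Multiset.pairwise_sort _ _)

theorem flatten_monomialFactorization_injective :
    Function.Injective fun m : {w : List A // IsLyndon w} →₀ ℕ =>
      (monomialFactorization m).flatten := by
  intro m m' h
  have h1 := (isLyndonFactorization_monomialFactorization m).eq_of_flatten_eq
    (isLyndonFactorization_monomialFactorization m') h
  have h2 := List.map_injective_iff.2 Subtype.val_injective h1
  have h3 := congrArg (fun l : List {w : List A // IsLyndon w} => Multiset.ofList l) h2
  simp only [Multiset.sort_eq] at h3
  classical
  simpa using congrArg Multiset.toFinsupp h3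

theorem exists_flatten_monomialFactorization (w : List A) :
    ∃ m : {w : List A // IsLyndon w} →₀ ℕ, (monomialFactorization m).flatten = w := by
  obtain ⟨L, hL, rfl⟩ := IsLyndonFactorization.exists_flatten_eq w
  lift L to List {w : List A // IsLyndon w} using hL.1
  refine ⟨Multiset.toFinsupp (L : Multiset {w : List A // IsLyndon w}), ?_⟩
  have h : (L : Multiset {w : List A // IsLyndon w}).sort (· ≥ ·) = L :=
    List.Perm.eq_of_pairwise (fun a b _ _ h₁ h₂ => le_antisymm h₂ h₁) (Multiset.pairwise_sort _ _)
      (List.pairwise_map.1 hL.2) (Multiset.coe_eq_coe.1 (Multiset.sort_eq _ _))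
  rw [monomialFactorization, Multiset.toFinsupp_toMultiset, h]

theorem aeval_monomial_eq_prod (m : {w : List A // IsLyndon w} →₀ ℕ) (r : k) :
    MvPolynomial.aeval (fun w : {w : List A // IsLyndon w} => word k B w)
      (MvPolynomial.monomial m r) = r • ((monomialFactorization m).map (word k B)).prod := by
  rw [MvPolynomial.aeval_monomial, ← Algebra.smul_def]
  congr 1
  rw [monomialFactorization, List.map_map, ← Multiset.prod_coe, ← Multiset.map_coe,
    Multiset.sort_eq, Finsupp.toMultiset_map, Finsupp.prod_toMultiset,
    Finsupp.prod_mapDomain_index pow_zero pow_add]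
  rfl

theorem aeval_word_bijective [CharZero k] : Function.Bijective
    (MvPolynomial.aeval (fun w : {w : List A // IsLyndon w} => word k B w) :
      MvPolynomial {w : List A // IsLyndon w} k →ₐ[k] QuasiShuffle k B) := by
  constructor
  · rw [injective_iff_map_eq_zero]
    intro p hp
    rw [← MvPolynomial.support_eq_empty]
    refine eq_empty_of_sum_eq_zero flatten_monomialFactorization_injective
      (fun m => hasLeadingWord_prod (k := k) (B := B)
        (isLyndonFactorization_monomialFactorization m)) p.support (fun m => p.coeff m) ?_
      fun m hm => MvPolynomial.mem_support_iff.1 hm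
    conv_rhs => rw [← hp, p.as_sum, map_sum]
    exact Finset.sum_congr rfl fun m _ => (aeval_monomial_eq_prod m _).symm
  · rw [← AlgHom.coe_toLinearMap, ← LinearMap.range_eq_top]
    refine eq_top_of_hasLeadingWord fun w => ?_
    obtain ⟨m, rfl⟩ := exists_flatten_monomialFactorization w
    refine ⟨_, ⟨MvPolynomial.monomial m 1, ?_⟩,
      hasLeadingWord_prod (isLyndonFactorization_monomialFactorization m)⟩
    rw [AlgHom.toLinearMap_apply, aeval_monomial_eq_prod, one_smul]

end QuasiShuffle

theorem theorem2p6 (k : Subfield ℂ) {A : Type*} [LinearOrder A] (deg : A → ℕ)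
    (deg_pos : ∀ a, 0 < deg a) (locally_finite : ∀ n, {a | deg a = n}.Finite)
    (B : LetterBracket deg) :
    Function.Bijective
      (MvPolynomial.aeval (fun w : {w : List A // IsLyndon w} => QuasiShuffle.word k B w) :
        MvPolynomial {w : List A // IsLyndon w} k →ₐ[k] QuasiShuffle k B) :=
  QuasiShuffle.aeval_word_bijective
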